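/- Let $G$ be a real, connected, compact, semisimple Lie group (finite-dimensional, Hausdorff; semisimple means that the Lie algebra $\mathfrak g$ of $G$ has zero solvable radical). Let $\mathcal X$ be a linear vector field on $G$, i.e. a smooth vector field whose flow $(\varphi_t)_{t\in\mathbb R}$, given by $\frac{d}{dt}\varphi_t(g)=\mathcal X(\varphi_t(g))$ and $\varphi_0(g)=g$, is defined for all $t \in \mathbb R$ and consists of Lie group automorphisms of $G$. Then every fixed point $g$ of the flow $\varphi_t$ (that is, $\varphi_t(g)=g$ for all $t\in\mathbb R$) is Lyapunov stable: for every neighborhood $U$ of $g$ there is a neighborhood $V$ of $g$ such that $\varphi_t(V)\subset U$ for all $t\ge 0$. -/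

import Mathlib

open scoped Manifold ContDiff Topology

section LinearFlow

variable {E : Type*} [NormedAddCommGroup E] [NormedSpace ℝ E]
  {H : Type*} [TopologicalSpace H] (I : ModelWithCorners ℝ E H)
  {G : Type*} [TopologicalSpace G] [ChartedSpace H G] [Group G]

/-- A smooth real Lie group has the regularity under which Mathlib equips `GroupLieAlgebra I G`
with its Lie algebra structure. -/
instance LieGroup.minSmoothness_of_smooth [LieGroup I ∞ G] :
    LieGroup I (minSmoothness ℝ 3) G := by
  rw [minSmoothness_of_isRCLikeNormedField]
  infer_instance

variable (G) in
/-- A real Lie group is semisimple if its Lie algebra is, that is, if the largest solvable ideal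
of its Lie algebra is zero. -/
def IsSemisimpleLieGroup [FiniteDimensional ℝ E] [LieGroup I ∞ G] : Prop :=
  haveI : CompleteSpace E := FiniteDimensional.complete ℝ E
  LieAlgebra.HasTrivialRadical ℝ (GroupLieAlgebra I G)

/-- `φ` is the (global) flow of the vector field `X`: for every `g`, the curve `t ↦ φ t g`,
defined for all real `t`, solves `ġ = X(g)` with initial value `g`. -/
structure IsFlowOf (φ : ℝ → G → G) (X : (g : G) → TangentSpace I g) : Prop where
  zero_apply : ∀ g : G, φ 0 g = g
  isMIntegralCurve : ∀ g : G, IsMIntegralCurve (I := I) (fun t => φ t g) X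

/-- `f` is an automorphism of the Lie group `G`: a group automorphism that is a diffeomorphism. -/
def IsLieGroupAutomorphism (f : G → G) : Prop :=
  ∃ e : G ≃* G, ⇑e = f ∧ ContMDiff I I ∞ e ∧ ContMDiff I I ∞ e.symm

/-- A smooth vector field on a Lie group is linear if it has a global flow which consists of
automorphisms of the Lie group. -/
structure IsLinearVectorField [LieGroup I ∞ G] (X : (g : G) → TangentSpace I g) : Prop where
  contMDiff : ContMDiff I I.tangent ∞ (fun g => (⟨g, X g⟩ : TangentBundle I G))
  exists_flow : ∃ φ : ℝ → G → G, IsFlowOf I φ X ∧ ∀ t : ℝ, IsLieGroupAutomorphism I (φ t)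

end LinearFlow

/-- `g` is a fixed point of the flow `φ`. -/
def IsFlowFixedPoint {G : Type*} (φ : ℝ → G → G) (g : G) : Prop :=
  ∀ t : ℝ, φ t g = g

/-- Lyapunov stability of the point `g`: every neighbourhood `U` of `g` contains all forward images
`φ t '' V`, `t ≥ 0`, of some neighbourhood `V` of `g`. -/
def IsStablePoint {G : Type*} [TopologicalSpace G] (φ : ℝ → G → G) (g : G) : Prop :=
  ∀ U ∈ 𝓝 g, ∃ V ∈ 𝓝 g, ∀ t : ℝ, 0 ≤ t → φ t '' V ⊆ U

/-!
Let `F x = tr (Ad x)` be the character of the adjoint representation of `G`. If `f` is an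
automorphism of `G` with differential `df` at `1`, then `Ad (f x) = df ∘ Ad x ∘ df⁻¹`, so `F` is
invariant under all automorphisms. By compactness `Ad x` is orthogonal for a suitable inner product,
whence `F x < F 1` unless `Ad x = 1`; and since the Lie algebra has trivial centre, the kernel of
`Ad` is discrete. So `F` has a strict local maximum at `1`, and a small compact neighbourhood `K` of
`1` is surrounded by a barrier, its frontier, on which `F` is smaller than at all points near `1`.
The image under an automorphism of a small connected neighbourhood of `1` contains `1` and cannot
cross the barrier, hence stays in `K`. A fixed point `g` is handled through `f (g * x) = g * f x`.

That the kernel of `Ad` is discrete is read off from the multiplication `m` in a chart at `1`. The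
bracket of `v` and `w` is the antisymmetrisation of the mixed second derivative of `m`, so when the
centre is trivial, the difference of the derivatives at `1` of `x ↦ h * x` and `x ↦ x * h` vanishes
to exactly first order at `h = 1`; and if `Ad h = 1`, these two derivatives coincide.
-/

open MeasureTheory Filter Set

section StableUnderInvariance

theorem exists_nhds_image_subset_of_strict_local_max {X α : Type*} [TopologicalSpace X]
    [LocallyConnectedSpace X] [WeaklyLocallyCompactSpace X] [R1Space X]
    [LinearOrder α] [TopologicalSpace α] [OrderClosedTopology α]
    {F : X → α} (hF : Continuous F) {x₀ : X} (hmax : ∀ᶠ x in 𝓝[≠] x₀, F x < F x₀)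
    {U : Set X} (hU : U ∈ 𝓝 x₀) :
    ∃ V ∈ 𝓝 x₀, ∀ f : X → X, ContinuousOn f V → f x₀ = x₀ → (∀ x ∈ V, F x ≤ F (f x)) →
      f '' V ⊆ U := by
  obtain ⟨K, ⟨hKx₀, hKcompact, hKclosed⟩, hKU⟩ := (isCompact_isClosed_basis_nhds x₀).mem_iff.1
    (inter_mem hU (eventually_nhdsWithin_iff.1 hmax))
  have hx₀K : x₀ ∈ interior K := mem_interior_iff_mem_nhds.2 hKx₀
  have hfrontier_lt : ∀ y ∈ frontier K, F y < F x₀ := fun y hy =>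
    (hKU (hKclosed.frontier_subset hy)).2 fun hyx₀ => hy.2 (hyx₀ ▸ hx₀K)
  have hbarrier : ∀ᶠ x in 𝓝 x₀, ∀ y ∈ frontier K, F y < F x :=
    (hKcompact.of_isClosed_subset isClosed_frontier
      hKclosed.frontier_subset).eventually_forall_of_forall_eventually fun y hy =>
        ((hF.comp continuous_snd).tendsto _).eventually_lt ((hF.comp continuous_fst).tendsto _)
          (hfrontier_lt y hy)
  obtain ⟨V, hVbarrier, hVopen, hx₀V, hVconn⟩ :=
    locallyConnectedSpace_iff_subsets_isOpen_isConnected.1 ‹_› x₀ _ hbarrier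
  refine ⟨V, hVopen.mem_nhds hx₀V, fun f hf hfx₀ hle => ?_⟩
  have hno_crossing : closure (interior K) ∩ f '' V ⊆ interior K := by
    rintro _ ⟨hK, x, hx, rfl⟩
    by_contra hint
    exact (hle x hx).not_gt (hVbarrier hx _ ⟨closure_mono interior_subset hK, hint⟩)
  have hstay : f '' V ⊆ interior K :=
    (hVconn.isPreconnected.image f hf).subset_of_closure_inter_subset isOpen_interior
      ⟨x₀, ⟨x₀, hx₀V, hfx₀⟩, hx₀K⟩ hno_crossing
  exact hstay.trans (interior_subset.trans (hKU.trans inter_subset_left))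

end StableUnderInvariance

section CharacterOfCompactGroup

variable {𝕜 : Type*} [RCLike 𝕜]

theorem norm_map_sub_self_sq_le {V : Type*} [NormedAddCommGroup V] [InnerProductSpace 𝕜 V]
    {A : V →ₗ[𝕜] V} (hA : ∀ x, ‖A x‖ ≤ ‖x‖) (x : V) :
    ‖A x - x‖ ^ 2 ≤ 2 * (‖x‖ ^ 2 - RCLike.re (inner 𝕜 x (A x))) := by
  rw [norm_sub_sq (𝕜 := 𝕜), inner_re_symm]
  linarith [pow_le_pow_left₀ (norm_nonneg _) (hA x) 2]

theorem re_trace_lt_finrank_of_norm_map_le {V : Type*} [NormedAddCommGroup V]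
    [InnerProductSpace 𝕜 V] [FiniteDimensional 𝕜 V] {A : V →ₗ[𝕜] V} (hA : ∀ x, ‖A x‖ ≤ ‖x‖)
    (hne : A ≠ 1) : RCLike.re (LinearMap.trace 𝕜 V A) < Module.finrank 𝕜 V := by
  let b := stdOrthonormalBasis 𝕜 V
  have hdist (i) : ‖A (b i) - b i‖ ^ 2 ≤ 2 * (1 - RCLike.re (inner 𝕜 (b i) (A (b i)))) := by
    simpa using norm_map_sub_self_sq_le hA (b i)
  obtain ⟨j, hj⟩ : ∃ j, A (b j) ≠ b j := by
    by_contra! h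
    exact hne (b.toBasis.ext fun i => by simpa using h i)
  have hj_lt : RCLike.re (inner 𝕜 (b j) (A (b j))) < 1 := by
    have : 0 < ‖A (b j) - b j‖ ^ 2 := by have := sub_ne_zero.2 hj; positivity
    linarith [hdist j]
  calc RCLike.re (LinearMap.trace 𝕜 V A)
      = ∑ i, RCLike.re (inner 𝕜 (b i) (A (b i))) := by
        rw [LinearMap.trace_eq_sum_inner A b, map_sum]
    _ < ∑ _i : Fin (Module.finrank 𝕜 V), (1 : ℝ) :=
        Finset.sum_lt_sum (fun i _ => by linarith [hdist i, sq_nonneg ‖A (b i) - b i‖])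
          ⟨j, Finset.mem_univ j, hj_lt⟩
    _ = Module.finrank 𝕜 V := by simp

variable {K V : Type*} [TopologicalSpace K] [Group K] [IsTopologicalGroup K] [CompactSpace K]
  [AddCommGroup V] [Module 𝕜 V] [TopologicalSpace V] [IsTopologicalAddGroup V]
  [ContinuousSMul 𝕜 V] [T2Space V] [FiniteDimensional 𝕜 V]

theorem exists_invariant_innerProductSpaceCore (ρ : Representation 𝕜 K V)
    (hρ : ∀ x, Continuous fun a => ρ a x) :
    ∃ c : InnerProductSpace.Core 𝕜 V, ∀ a x y, c.inner (ρ a x) (ρ a y) = c.inner x y := by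
  borelize K
  let μ : Measure K := Measure.haar
  let T : V ≃L[𝕜] EuclideanSpace 𝕜 (Fin (Module.finrank 𝕜 V)) :=
    ContinuousLinearEquiv.ofFinrankEq (by simp)
  -- The inverses turn left invariance of `μ` into invariance of the average under `ρ`.
  let f (x y : V) (a : K) : 𝕜 := inner 𝕜 (T (ρ a⁻¹ x)) (T (ρ a⁻¹ y))
  have hf (x y : V) : Continuous (f x y) :=
    (T.continuous.comp ((hρ x).comp continuous_inv)).inner
      (T.continuous.comp ((hρ y).comp continuous_inv))
  have hint (x y : V) : Integrable (f x y) μ :=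
    (hf x y).integrable_of_hasCompactSupport (.of_compactSpace _)
  have hre (x : V) (a : K) : RCLike.re (f x x a) = ‖T (ρ a⁻¹ x)‖ ^ 2 := inner_self_eq_norm_sq _
  have hre_integral (x : V) : RCLike.re (∫ a, f x x a ∂μ) = ∫ a, ‖T (ρ a⁻¹ x)‖ ^ 2 ∂μ := by
    simp_rw [← hre, integral_re (hint x x)]
  refine ⟨{ inner := fun x y => ∫ a, f x y a ∂μ
            conj_inner_symm := fun x y => ?_
            re_inner_nonneg := fun x => ?_
            add_left := fun x y z => ?_
            smul_left := fun x y r => ?_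
            definite := fun x hx => ?_ }, fun h x y => ?_⟩
  · rw [← integral_conj]
    exact integral_congr_ae (.of_forall fun a => inner_conj_symm _ _)
  · exact (hre_integral x).symm ▸ integral_nonneg fun a => by positivity
  · rw [← integral_add (hint x z) (hint y z)]
    simp only [f, map_add, inner_add_left]
  · rw [← integral_const_mul]
    simp only [f, map_smul, inner_smul_left]
  · by_contra hne
    have hpos : 0 < ∫ a, ‖T (ρ a⁻¹ x)‖ ^ 2 ∂μ :=
      Continuous.integral_pos_of_hasCompactSupport_nonneg_nonzero (x := 1)
        ((T.continuous.comp ((hρ x).comp continuous_inv)).norm.pow 2)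
        (.of_compactSpace _) (fun a => by positivity) (by simp [hne])
    rw [← hre_integral] at hpos
    simp [hx] at hpos
  · have := integral_mul_left_eq_self (μ := μ) (f x y) h⁻¹
    simp only [f, mul_inv_rev, inv_inv, map_mul, Module.End.mul_apply] at this
    exact this

theorem re_trace_lt_finrank_of_ne_one (ρ : Representation 𝕜 K V)
    (hρ : ∀ x, Continuous fun a => ρ a x) {a : K} (ha : ρ a ≠ 1) :
    RCLike.re (LinearMap.trace 𝕜 V (ρ a)) < Module.finrank 𝕜 V := by
  obtain ⟨c, hc⟩ := exists_invariant_innerProductSpaceCore ρ hρ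
  let : NormedAddCommGroup V := c.toNormedAddCommGroup
  let : InnerProductSpace 𝕜 V := .ofCore c.toCore
  refine re_trace_lt_finrank_of_norm_map_le (fun x => le_of_eq ?_) ha
  exact congrArg (fun r : 𝕜 => √(RCLike.re r)) (hc a x x)

end CharacterOfCompactGroup

section MixedDerivative

variable {𝕜 : Type*} [NontriviallyNormedField 𝕜]
  {E : Type*} [NormedAddCommGroup E] [NormedSpace 𝕜 E]
  {F : Type*} [NormedAddCommGroup F] [NormedSpace 𝕜 F]
  {G : Type*} [NormedAddCommGroup G] [NormedSpace 𝕜 G]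

variable (𝕜) in
/-- The mixed second derivative of a function of two variables: the restriction of its second
derivative at `z` to pairs consisting of a vector along the first factor and a vector along the
second one. -/
noncomputable def mixedFDeriv (f : E × F → G) (z : E × F) : E →L[𝕜] F →L[𝕜] G :=
  (fderiv 𝕜 (fderiv 𝕜 f) z).bilinearComp (.inl 𝕜 E F) (.inr 𝕜 E F)

theorem hasFDerivAt_fderiv_snd {f : E × F → G} {a : E} {b : F} (hf : ContDiffAt 𝕜 2 f (a, b)) :
    HasFDerivAt (fun x => fderiv 𝕜 (fun y => f (x, y)) b) (mixedFDeriv 𝕜 f (a, b)) a := by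
  have hdf : DifferentiableAt 𝕜 (fderiv 𝕜 f) (a, b) :=
    (hf.fderiv_right (m := 1) (by norm_num)).differentiableAt (by simp)
  have hincl : HasFDerivAt (fun x => (x, b)) (.inl 𝕜 E F) a := hasFDerivAt_prodMk_left a b
  have hpartial : ∀ᶠ x in 𝓝 a,
      fderiv 𝕜 (fun y => f (x, y)) b = fderiv 𝕜 f (x, b) ∘L .inr 𝕜 E F := by
    filter_upwards [hincl.continuousAt.eventually (hf.eventually (by simp))] with x hx
    exact ((hx.differentiableAt (by simp)).hasFDerivAt.comp b (hasFDerivAt_prodMk_right x b)).fderiv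
  exact (((ContinuousLinearMap.compL 𝕜 F (E × F) G).flip (.inr 𝕜 E F)).hasFDerivAt.comp a
    (HasFDerivAt.comp (f := fun x => (x, b)) a hdf.hasFDerivAt hincl)).congr_of_eventuallyEq
      hpartial

theorem hasFDerivAt_fderiv_fst {n : ℕ∞ω} {f : E × F → G} {a : E} {b : F}
    (hf : ContDiffAt 𝕜 n f (a, b)) (hn : minSmoothness 𝕜 2 ≤ n) :
    HasFDerivAt (fun y => fderiv 𝕜 (fun x => f (x, y)) a) (mixedFDeriv 𝕜 f (a, b)).flip b := by
  have hsymm := hf.isSymmSndFDerivAt hn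
  have hf2 : ContDiffAt 𝕜 2 f (a, b) := hf.of_le (le_minSmoothness.trans hn)
  have hdf : DifferentiableAt 𝕜 (fderiv 𝕜 f) (a, b) :=
    (hf2.fderiv_right (m := 1) (by norm_num)).differentiableAt (by simp)
  have hincl : HasFDerivAt (fun y => (a, y)) (.inr 𝕜 E F) b := hasFDerivAt_prodMk_right a b
  have hpartial : ∀ᶠ y in 𝓝 b,
      fderiv 𝕜 (fun x => f (x, y)) a = fderiv 𝕜 f (a, y) ∘L .inl 𝕜 E F := by
    filter_upwards [hincl.continuousAt.eventually (hf2.eventually (by simp))] with y hy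
    exact ((hy.differentiableAt (by simp)).hasFDerivAt.comp a (hasFDerivAt_prodMk_left a y)).fderiv
  refine HasFDerivAt.congr_fderiv ((((ContinuousLinearMap.compL 𝕜 E (E × F) G).flip
    (.inl 𝕜 E F)).hasFDerivAt.comp b (HasFDerivAt.comp (f := fun y => (a, y)) b hdf.hasFDerivAt
      hincl)).congr_of_eventuallyEq hpartial) ?_
  ext w v
  exact hsymm.eq (0, w) (v, 0)

end MixedDerivative

section Manifold

variable {𝕜 : Type*} [NontriviallyNormedField 𝕜]
  {E : Type*} [NormedAddCommGroup E] [NormedSpace 𝕜 E]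
  {H : Type*} [TopologicalSpace H] (I : ModelWithCorners 𝕜 E H)
  {E' : Type*} [NormedAddCommGroup E'] [NormedSpace 𝕜 E']
  {H' : Type*} [TopologicalSpace H'] (I' : ModelWithCorners 𝕜 E' H')
  {M : Type*} [TopologicalSpace M] [ChartedSpace H M]
  {M' : Type*} [TopologicalSpace M'] [ChartedSpace H' M'] [IsManifold I' 1 M']

theorem inTangentCoordinates_eq_self [IsManifold I 1 M] {N : Type*} {f : N → M} {g : N → M'}
    {ϕ : N → E →L[𝕜] E'} {x₀ x : N} (hf : f x = f x₀) (hg : g x = g x₀) :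
    inTangentCoordinates I I' f g ϕ x₀ x = ϕ x := by
  rw [inTangentCoordinates_eq f g ϕ (hf ▸ mem_chart_source H (f x))
    (hg ▸ mem_chart_source H' (g x)), hf, hg]
  ext v
  exact ((tangentBundleCore I' M').coordChange_self _ _ (mem_chart_source H' (g x₀)) _).trans
    (congrArg (ϕ x) ((tangentBundleCore I M).coordChange_self _ _ (mem_chart_source H (f x₀)) v))

theorem fderiv_extChartAt_comp [I.Boundaryless] {f : M → M'} {x : M} {y z : M'}
    (hf : MDifferentiableAt I I' f x) (hfx : f x = z) (hz : z ∈ (extChartAt I' y).source) :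
    fderiv 𝕜 (fun q => extChartAt I' y (f ((extChartAt I x).symm q))) (extChartAt I x x) =
      (mfderiv I' 𝓘(𝕜, E') (extChartAt I' y) z : E' →L[𝕜] E') ∘L
        (mfderiv I I' f x : E →L[𝕜] E') := by
  subst hfx
  have hchart : MDifferentiableAt I' 𝓘(𝕜, E') (extChartAt I' y) (f x) :=
    mdifferentiableAt_extChartAt (by simpa using hz)
  have hcomp : mfderiv I 𝓘(𝕜, E') (extChartAt I' y ∘ f) x =
      fderivWithin 𝕜 (fun q => extChartAt I' y (f ((extChartAt I x).symm q))) (range I)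
        (extChartAt I x x) := (hchart.comp x hf).mfderiv
  rw [I.range_eq_univ, fderivWithin_univ] at hcomp
  exact hcomp.symm.trans (mfderiv_comp x hchart hf)

end Manifold

section AdjointRepresentation

variable {𝕜 : Type*} [NontriviallyNormedField 𝕜]
  {E : Type*} [NormedAddCommGroup E] [NormedSpace 𝕜 E]
  {H : Type*} [TopologicalSpace H] (I : ModelWithCorners 𝕜 E H)
  {E' : Type*} [NormedAddCommGroup E'] [NormedSpace 𝕜 E']
  {H' : Type*} [TopologicalSpace H'] (I' : ModelWithCorners 𝕜 E' H')
  {E'' : Type*} [NormedAddCommGroup E''] [NormedSpace 𝕜 E'']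
  {H'' : Type*} [TopologicalSpace H''] (I'' : ModelWithCorners 𝕜 E'' H'')
  {G : Type*} [TopologicalSpace G] [ChartedSpace H G] [Group G]
  {G' : Type*} [TopologicalSpace G'] [ChartedSpace H' G'] [Group G']
  {G'' : Type*} [TopologicalSpace G''] [ChartedSpace H'' G''] [Group G'']

/-- The linear map between Lie algebras induced by a homomorphism of Lie groups, that is, its
derivative at the identity. Since all tangent spaces are copies of the model vector space, the
tangent space at `f 1` need not be transported to the one at `1`. -/
noncomputable def groupLieAlgebraMap (f : G →* G') :
    GroupLieAlgebra I G →ₗ[𝕜] GroupLieAlgebra I' G' :=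
  (mfderiv I I' f (1 : G)).toLinearMap

@[simp]
theorem groupLieAlgebraMap_id : groupLieAlgebraMap I I (MonoidHom.id G) = 1 :=
  congrArg ContinuousLinearMap.toLinearMap (mfderiv_id (I := I) (x := (1 : G)))

theorem groupLieAlgebraMap_comp {f' : G' →* G''} {f : G →* G'}
    (hf' : MDifferentiableAt I' I'' f' 1) (hf : MDifferentiableAt I I' f 1) :
    groupLieAlgebraMap I I'' (f'.comp f) =
      groupLieAlgebraMap I' I'' f' ∘ₗ groupLieAlgebraMap I I' f := by
  have hcomp := mfderiv_comp_of_eq hf' hf (map_one f)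
  rw [map_one] at hcomp
  exact congrArg ContinuousLinearMap.toLinearMap hcomp

theorem groupLieAlgebraMap_mul_symm {e : G ≃* G} (he : MDifferentiableAt I I e 1)
    (he' : MDifferentiableAt I I e.symm 1) :
    groupLieAlgebraMap I I e.toMonoidHom * groupLieAlgebraMap I I e.symm.toMonoidHom = 1 := by
  rw [← groupLieAlgebraMap_id I, Module.End.mul_eq_comp, ← groupLieAlgebraMap_comp I I I he he']
  congr 1
  ext x
  simp

variable [LieGroup I (minSmoothness 𝕜 3) G]

theorem mdifferentiable_conj (h : G) : MDifferentiable I I (MulAut.conj h) :=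
  ((contMDiff_const.mul contMDiff_id).mul contMDiff_const).mdifferentiable
    (lt_of_lt_of_le (by simp) (le_minSmoothness (𝕜 := 𝕜) (n := 3))).ne'

/-- The adjoint representation of a Lie group on its Lie algebra: `adjointRep I h` is the derivative
at the identity of the conjugation `x ↦ h * x * h⁻¹`. -/
noncomputable def adjointRep : Representation 𝕜 G (GroupLieAlgebra I G) where
  toFun h := groupLieAlgebraMap I I (MulAut.conj h).toMonoidHom
  map_one' := by
    rw [map_one]
    exact groupLieAlgebraMap_id I
  map_mul' a b := by
    rw [map_mul]
    exact groupLieAlgebraMap_comp I I I (f' := (MulAut.conj a).toMonoidHom)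
      (f := (MulAut.conj b).toMonoidHom) (mdifferentiable_conj I a 1) (mdifferentiable_conj I b 1)

theorem adjointRep_map_comp {e : G ≃* G} (he : MDifferentiableAt I I e 1) (h : G) :
    adjointRep I (e h) ∘ₗ groupLieAlgebraMap I I e.toMonoidHom =
      groupLieAlgebraMap I I e.toMonoidHom ∘ₗ adjointRep I h := by
  refine ((groupLieAlgebraMap_comp I I I (mdifferentiable_conj I (e h) 1) he).symm.trans ?_).trans
    (groupLieAlgebraMap_comp I I I he (mdifferentiable_conj I h 1))
  congr 1
  ext x
  simp

theorem trace_adjointRep_map {e : G ≃* G} (he : MDifferentiableAt I I e 1)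
    (he' : MDifferentiableAt I I e.symm 1) (h : G) :
    LinearMap.trace 𝕜 _ (adjointRep I (e h)) = LinearMap.trace 𝕜 _ (adjointRep I h) := by
  set de := groupLieAlgebraMap I I e.toMonoidHom
  set de' := groupLieAlgebraMap I I e.symm.toMonoidHom
  calc LinearMap.trace 𝕜 _ (adjointRep I (e h))
      = LinearMap.trace 𝕜 _ (adjointRep I (e h) * de * de') := by
        rw [mul_assoc, groupLieAlgebraMap_mul_symm I he he', mul_one]
    _ = LinearMap.trace 𝕜 _ (de * adjointRep I h * de') := by
        rw [Module.End.mul_eq_comp (adjointRep I (e h)), adjointRep_map_comp I he,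
          Module.End.mul_eq_comp de]
    _ = LinearMap.trace 𝕜 _ (de' * de * adjointRep I h) := by
        rw [LinearMap.trace_mul_comm, mul_assoc]
    _ = LinearMap.trace 𝕜 _ (adjointRep I h) := by
        rw [show de' * de = 1 from groupLieAlgebraMap_mul_symm I (e := e.symm) he' he, one_mul]

theorem continuous_adjointRep_apply (v : GroupLieAlgebra I G) :
    Continuous fun h : G => adjointRep I h v := by
  have hconj : ContMDiff (I.prod I) I (minSmoothness 𝕜 3) fun p : G × G => p.1 * p.2 * p.1⁻¹ :=
    (contMDiff_fst.mul contMDiff_snd).mul contMDiff_fst.inv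
  have hone_le : (1 : ℕ∞ω) ≤ minSmoothness 𝕜 3 :=
    le_minSmoothness.trans (minSmoothness_monotone (by norm_num))
  refine continuous_iff_continuousAt.2 fun h => ?_
  have hcoord : ContinuousAt (inTangentCoordinates I I (fun _ : G => (1 : G))
      (fun x => x * 1 * x⁻¹) (fun x => mfderiv I I (fun y => x * y * x⁻¹) 1) h) h :=
    (ContMDiffAt.mfderiv (m := 0) (fun h x : G => h * x * h⁻¹) (fun _ => (1 : G)) (hconj (h, 1))
      contMDiffAt_const (by simpa using hone_le)).continuousAt
  -- All the derivatives are maps from the tangent space at `1` to itself, so the coordinate changes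
  -- hidden in `inTangentCoordinates` are trivial.
  refine (hcoord.clm_apply (continuousAt_const (y := (v : E)))).congr (.of_forall fun x => ?_)
  exact congrArg (fun T : E →L[𝕜] E => T v) (inTangentCoordinates_eq_self I I rfl (by simp))

theorem mfderiv_mul_left_eq_mfderiv_mul_right_adjointRep (h : G) (v : GroupLieAlgebra I G) :
    (mfderiv I I (h * ·) (1 : G) v : E) = (mfderiv I I (· * h) (1 : G) (adjointRep I h v) : E) := by
  have hright : MDifferentiableAt I I (· * h) (1 : G) :=
    (contMDiff_mul_right (n := minSmoothness 𝕜 3)).mdifferentiableAt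
      (lt_of_lt_of_le (by simp) le_minSmoothness).ne'
  have hcomp := mfderiv_comp_of_eq hright (mdifferentiable_conj I h 1) (map_one _)
  have hmul : (· * h) ∘ MulAut.conj h = (h * ·) := by
    ext x
    simp
  rw [hmul, map_one] at hcomp
  exact congrArg (fun T : E →L[𝕜] E => T v) hcomp

end AdjointRepresentation

section ChartMul

variable {𝕜 : Type*} [NontriviallyNormedField 𝕜]
  {E : Type*} [NormedAddCommGroup E] [NormedSpace 𝕜 E]
  {H : Type*} [TopologicalSpace H] (I : ModelWithCorners 𝕜 E H)
  (G : Type*) [TopologicalSpace G] [ChartedSpace H G] [Group G]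

/-- Multiplication of a Lie group, read in the preferred chart at the identity. -/
noncomputable def chartMul (z : E × E) : E :=
  extChartAt I (1 : G) ((extChartAt I (1 : G)).symm z.1 * (extChartAt I (1 : G)).symm z.2)

variable [I.Boundaryless] [LieGroup I (minSmoothness 𝕜 3) G]

theorem contDiffAt_chartMul : ContDiffAt 𝕜 (minSmoothness 𝕜 3) (chartMul I G)
    (extChartAt I (1 : G) 1, extChartAt I (1 : G) 1) := by
  have hsymm : ContMDiffAt 𝓘(𝕜, E) I (minSmoothness 𝕜 3) (extChartAt I (1 : G)).symm
      (extChartAt I (1 : G) 1) :=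
    (contMDiffOn_extChartAt_symm 1).contMDiffAt (extChartAt_target_mem_nhds 1)
  have hmul : ContMDiffAt 𝓘(𝕜, E × E) I (minSmoothness 𝕜 3)
      (fun z : E × E => (extChartAt I (1 : G)).symm z.1 * (extChartAt I (1 : G)).symm z.2)
      (extChartAt I (1 : G) 1, extChartAt I (1 : G) 1) :=
    (ContMDiffAt.comp_of_eq hsymm contDiffAt_fst.contMDiffAt rfl).mul
      (ContMDiffAt.comp_of_eq hsymm contDiffAt_snd.contMDiffAt rfl)
  exact contMDiffAt_iff_contDiffAt.1
    (ContMDiffAt.comp_of_eq (contMDiffAt_extChartAt (x := (1 : G))) hmul (by simp))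

variable {G}

theorem fderiv_chartMul_snd {h : G} (hh : h ∈ (extChartAt I (1 : G)).source) :
    fderiv 𝕜 (fun q => chartMul I G (extChartAt I 1 h, q)) (extChartAt I (1 : G) 1) =
      (mfderiv I 𝓘(𝕜, E) (extChartAt I (1 : G)) h : E →L[𝕜] E) ∘L
        (mfderiv I I (h * ·) (1 : G) : E →L[𝕜] E) := by
  have hmul : MDifferentiableAt I I (h * ·) (1 : G) :=
    (contMDiff_mul_left (n := minSmoothness 𝕜 3)).mdifferentiableAt
      (lt_of_lt_of_le (by simp) le_minSmoothness).ne'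
  simpa only [chartMul, (extChartAt I (1 : G)).left_inv hh] using
    fderiv_extChartAt_comp I I hmul (mul_one h) hh

theorem fderiv_chartMul_fst {h : G} (hh : h ∈ (extChartAt I (1 : G)).source) :
    fderiv 𝕜 (fun q => chartMul I G (q, extChartAt I 1 h)) (extChartAt I (1 : G) 1) =
      (mfderiv I 𝓘(𝕜, E) (extChartAt I (1 : G)) h : E →L[𝕜] E) ∘L
        (mfderiv I I (· * h) (1 : G) : E →L[𝕜] E) := by
  have hmul : MDifferentiableAt I I (· * h) (1 : G) :=
    (contMDiff_mul_right (n := minSmoothness 𝕜 3)).mdifferentiableAt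
      (lt_of_lt_of_le (by simp) le_minSmoothness).ne'
  simpa only [chartMul, (extChartAt I (1 : G)).left_inv hh] using
    fderiv_extChartAt_comp I I hmul (one_mul h) hh

theorem fderiv_chartMul_one :
    fderiv 𝕜 (fun q => chartMul I G (extChartAt I (1 : G) 1, q)) (extChartAt I (1 : G) 1) =
      .id 𝕜 E := by
  have hid : (mfderiv I I ((1 : G) * ·) (1 : G) : E →L[𝕜] E) = .id 𝕜 E := by
    rw [one_mul_eq_id]
    exact mfderiv_id
  rw [fderiv_chartMul_snd I (mem_extChartAt_source 1), mfderiv_extChartAt_self, hid]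
  rfl

theorem mpullbackWithin_extChartAt_symm_mulInvariantVectorField (v : GroupLieAlgebra I G) {p : E}
    (hp : p ∈ (extChartAt I (1 : G)).target) :
    VectorField.mpullbackWithin 𝓘(𝕜, E) I (extChartAt I (1 : G)).symm (mulInvariantVectorField v)
      (range I) p = fderiv 𝕜 (fun q => chartMul I G (p, q)) (extChartAt I (1 : G) 1) v := by
  obtain ⟨h, hh, rfl⟩ : ∃ h ∈ (extChartAt I (1 : G)).source, extChartAt I 1 h = p :=
    ⟨_, (extChartAt I (1 : G)).map_target hp, (extChartAt I (1 : G)).right_inv hp⟩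
  have hinv := ContinuousLinearMap.inverse_eq
    (mfderivWithin_extChartAt_symm_comp_mfderiv_extChartAt hp)
    (mfderiv_extChartAt_comp_mfderivWithin_extChartAt_symm hp)
  rw [VectorField.mpullbackWithin_apply, hinv, fderiv_chartMul_snd I hh,
    (extChartAt I (1 : G)).left_inv hh]
  rfl

theorem lie_eq_mixedFDeriv_chartMul_sub (v w : GroupLieAlgebra I G) :
    ⁅v, w⁆ = (mixedFDeriv 𝕜 (chartMul I G) (extChartAt I (1 : G) 1, extChartAt I (1 : G) 1) v w -
      mixedFDeriv 𝕜 (chartMul I G) (extChartAt I (1 : G) 1, extChartAt I (1 : G) 1) w v : E) := by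
  set o := extChartAt I (1 : G) 1
  set B := mixedFDeriv 𝕜 (chartMul I G) (o, o)
  let field (u : E) : E → E := VectorField.mpullbackWithin 𝓘(𝕜, E) I (extChartAt I (1 : G)).symm
    (mulInvariantVectorField (G := G) u) (range I)
  have hfield (u : E) : field u =ᶠ[𝓝 o] fun p => fderiv 𝕜 (fun q => chartMul I G (p, q)) o u := by
    filter_upwards [extChartAt_target_mem_nhds (I := I) (1 : G)] with p hp
    exact mpullbackWithin_extChartAt_symm_mulInvariantVectorField I u hp
  have hfield_o (u : E) : field u o = u := by
    rw [(hfield u).eq_of_nhds, fderiv_chartMul_one]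
    rfl
  have hderiv (u : E) : fderiv 𝕜 (field u) o = B.flip u := by
    have hB : HasFDerivAt (fun p => fderiv 𝕜 (fun q => chartMul I G (p, q)) o) B o :=
      hasFDerivAt_fderiv_snd ((contDiffAt_chartMul I G).of_le
        (le_minSmoothness.trans (minSmoothness_monotone (by norm_cast))))
    rw [(hfield u).fderiv_eq]
    exact ((ContinuousLinearMap.apply 𝕜 E u).hasFDerivAt.comp o hB).fderiv
  have hlie (u u' : E) : VectorField.lieBracketWithin 𝕜 (field u) (field u')
      ((extChartAt I (1 : G)).symm ⁻¹' univ ∩ range I) o = B u u' - B u' u := by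
    rw [preimage_univ, univ_inter, I.range_eq_univ, VectorField.lieBracketWithin_univ,
      VectorField.lieBracket, hderiv, hderiv, hfield_o, hfield_o]
    rfl
  have hinverse : (mfderiv I 𝓘(𝕜, E) (extChartAt I (1 : G)) 1 : E →L[𝕜] E).inverse = .id 𝕜 E := by
    rw [mfderiv_extChartAt_self]
    exact ContinuousLinearMap.inverse_id
  exact congrArg₂ (fun (T : E →L[𝕜] E) u => T u) hinverse (hlie v w)

theorem eventually_adjointRep_ne_one [CompleteSpace 𝕜] [FiniteDimensional 𝕜 E]
    (hcenter : ∀ v : GroupLieAlgebra I G, (∀ w : GroupLieAlgebra I G, ⁅v, w⁆ = 0) → v = 0) :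
    ∀ᶠ h in 𝓝[≠] (1 : G), adjointRep I h ≠ 1 := by
  set o := extChartAt I (1 : G) 1
  set B := mixedFDeriv 𝕜 (chartMul I G) (o, o)
  have hderiv : HasFDerivAt (fun p => fderiv 𝕜 (fun q => chartMul I G (p, q)) o -
      fderiv 𝕜 (fun q => chartMul I G (q, p)) o) (B - B.flip) o :=
    (hasFDerivAt_fderiv_snd ((contDiffAt_chartMul I G).of_le
      (le_minSmoothness.trans (minSmoothness_monotone (by norm_cast))))).sub
      (hasFDerivAt_fderiv_fst (contDiffAt_chartMul I G) (minSmoothness_monotone (by norm_cast)))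
  have hinj : (B - B.flip : E →ₗ[𝕜] E →L[𝕜] E).ker = ⊥ := LinearMap.ker_eq_bot'.2 fun v hv =>
    hcenter v fun w => (lie_eq_mixedFDeriv_chartMul_sub I v w).trans
      (congrArg (fun T : E →L[𝕜] E => T w) hv)
  obtain ⟨K, -, hK⟩ := LinearMap.exists_antilipschitzWith _ hinj
  have hne := eventually_nhdsWithin_iff.1 (hderiv.eventually_ne (c := 0) ⟨K, hK⟩)
  rw [eventually_nhdsWithin_iff]
  filter_upwards [(continuousAt_extChartAt (1 : G)).eventually hne,
    extChartAt_source_mem_nhds (I := I) (1 : G)] with h hh hsource h_ne_one hAd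
  refine hh (fun heq => h_ne_one ((extChartAt I 1).injOn hsource (mem_extChartAt_source 1) heq))
    (sub_eq_zero.2 ?_)
  rw [fderiv_chartMul_snd I hsource, fderiv_chartMul_fst I hsource]
  ext v
  refine congrArg _ ((mfderiv_mul_left_eq_mfderiv_mul_right_adjointRep I h v).trans ?_)
  rw [hAd]
  rfl

end ChartMul

section AdjointCharacter

theorem continuous_trace_of_continuous_apply {𝕜 V X : Type*} [NontriviallyNormedField 𝕜]
    [CompleteSpace 𝕜] [AddCommGroup V] [Module 𝕜 V] [TopologicalSpace V] [IsTopologicalAddGroup V]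
    [ContinuousSMul 𝕜 V] [T2Space V] [FiniteDimensional 𝕜 V] [TopologicalSpace X]
    {A : X → V →ₗ[𝕜] V} (hA : ∀ v, Continuous fun x => A x v) :
    Continuous fun x => LinearMap.trace 𝕜 V (A x) := by
  let b := Module.finBasis 𝕜 V
  simp only [LinearMap.trace_eq_matrix_trace 𝕜 b, Matrix.trace, Matrix.diag_apply,
    LinearMap.toMatrix_apply]
  exact continuous_finsetSum _ fun i _ =>
    (b.coord i).continuous_of_finiteDimensional.comp (hA (b i))

theorem continuous_trace_adjointRep {𝕜 : Type*} [NontriviallyNormedField 𝕜] [CompleteSpace 𝕜]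
    {E : Type*} [NormedAddCommGroup E] [NormedSpace 𝕜 E] [FiniteDimensional 𝕜 E]
    {H : Type*} [TopologicalSpace H] (I : ModelWithCorners 𝕜 E H)
    {G : Type*} [TopologicalSpace G] [ChartedSpace H G] [Group G]
    [LieGroup I (minSmoothness 𝕜 3) G] :
    Continuous fun h : G => LinearMap.trace 𝕜 _ (adjointRep I h) :=
  haveI : FiniteDimensional 𝕜 (GroupLieAlgebra I G) := inferInstanceAs (FiniteDimensional 𝕜 E)
  haveI : T2Space (GroupLieAlgebra I G) := inferInstanceAs (T2Space E)
  continuous_trace_of_continuous_apply (continuous_adjointRep_apply I)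

theorem eventually_re_trace_adjointRep_lt {𝕜 : Type*} [RCLike 𝕜]
    {E : Type*} [NormedAddCommGroup E] [NormedSpace 𝕜 E] [FiniteDimensional 𝕜 E]
    {H : Type*} [TopologicalSpace H] (I : ModelWithCorners 𝕜 E H) [I.Boundaryless]
    {G : Type*} [TopologicalSpace G] [ChartedSpace H G] [Group G]
    [LieGroup I (minSmoothness 𝕜 3) G] [CompactSpace G]
    (hcenter : ∀ v : GroupLieAlgebra I G, (∀ w : GroupLieAlgebra I G, ⁅v, w⁆ = 0) → v = 0) :
    ∀ᶠ h in 𝓝[≠] (1 : G), RCLike.re (LinearMap.trace 𝕜 _ (adjointRep I h)) <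
      RCLike.re (LinearMap.trace 𝕜 _ (adjointRep I (1 : G))) := by
  have : IsTopologicalGroup G := topologicalGroup_of_lieGroup I (minSmoothness 𝕜 3)
  have : FiniteDimensional 𝕜 (GroupLieAlgebra I G) := inferInstanceAs (FiniteDimensional 𝕜 E)
  have : T2Space (GroupLieAlgebra I G) := inferInstanceAs (T2Space E)
  filter_upwards [eventually_adjointRep_ne_one I hcenter] with h hh
  simpa only [map_one, LinearMap.trace_one, RCLike.natCast_re] using
    re_trace_lt_finrank_of_ne_one (adjointRep I) (continuous_adjointRep_apply I) hh

end AdjointCharacter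

section LinearVectorField

theorem IsFlowOf.unique {E : Type*} [NormedAddCommGroup E] [NormedSpace ℝ E] [CompleteSpace E]
    {H : Type*} [TopologicalSpace H] {I : ModelWithCorners ℝ E H}
    {M : Type*} [TopologicalSpace M] [ChartedSpace H M] [IsManifold I 1 M]
    [BoundarylessManifold I M] [T2Space M] {X : (x : M) → TangentSpace I x}
    (hX : ContMDiff I I.tangent 1 (fun x => (⟨x, X x⟩ : TangentBundle I M)))
    {φ ψ : ℝ → M → M} (hφ : IsFlowOf I φ X) (hψ : IsFlowOf I ψ X) : φ = ψ := by
  funext t x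
  exact congrFun (isMIntegralCurve_Ioo_eq_of_contMDiff_boundaryless (t₀ := 0) hX
    (hφ.isMIntegralCurve x) (hψ.isMIntegralCurve x) (by rw [hφ.zero_apply, hψ.zero_apply])) t

variable {E : Type*} [NormedAddCommGroup E] [NormedSpace ℝ E]
  {H : Type*} [TopologicalSpace H] {I : ModelWithCorners ℝ E H}
  {G : Type*} [TopologicalSpace G] [ChartedSpace H G] [Group G] [LieGroup I ∞ G]

theorem IsSemisimpleLieGroup.eq_zero_of_lie_eq_zero [FiniteDimensional ℝ E]
    (hG : IsSemisimpleLieGroup I G) {v : GroupLieAlgebra I G}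
    (hv : ∀ w : GroupLieAlgebra I G, ⁅v, w⁆ = 0) : v = 0 := by
  have : CompleteSpace E := FiniteDimensional.complete ℝ E
  have hcenter : v ∈ LieAlgebra.center ℝ (GroupLieAlgebra I G) :=
    (LieModule.mem_maxTrivSubmodule _ _ _ v).2 fun w => by rw [← lie_skew, hv, neg_zero]
  have hradical := LieAlgebra.center_le_radical ℝ (GroupLieAlgebra I G) hcenter
  rwa [hG.radical_eq_bot, LieSubmodule.mem_bot] at hradical

theorem IsLinearVectorField.isLieGroupAutomorphism [CompleteSpace E]
    [BoundarylessManifold I G] [T2Space G]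
    {X : (g : G) → TangentSpace I g} (hX : IsLinearVectorField I X)
    {φ : ℝ → G → G} (hφ : IsFlowOf I φ X) (t : ℝ) : IsLieGroupAutomorphism I (φ t) := by
  have : IsManifold I 1 G := IsManifold.of_le (n := ∞) (by simp)
  obtain ⟨ψ, hψ, haut⟩ := hX.exists_flow
  exact hφ.unique (hX.contMDiff.of_le (by simp)) hψ ▸ haut t

end LinearVectorField

theorem mainTheorem2_general
    {E : Type*} [NormedAddCommGroup E] [NormedSpace ℝ E] [FiniteDimensional ℝ E]
    {H : Type*} [TopologicalSpace H] (I : ModelWithCorners ℝ E H) [I.Boundaryless]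
    {G : Type*} [TopologicalSpace G] [ChartedSpace H G] [Group G] [LieGroup I ∞ G] [CompactSpace G]
    (hcenter : ∀ v : GroupLieAlgebra I G, (∀ w : GroupLieAlgebra I G, ⁅v, w⁆ = 0) → v = 0)
    {g : G} {U : Set G} (hU : U ∈ 𝓝 g) :
    ∃ V ∈ 𝓝 g, ∀ f : G → G, IsLieGroupAutomorphism I f → f g = g → f '' V ⊆ U := by
  have : IsTopologicalGroup G := topologicalGroup_of_lieGroup I ∞
  have : LocallyConnectedSpace H := I.toHomeomorph.locallyConnectedSpace
  have : LocallyConnectedSpace G := ChartedSpace.locallyConnectedSpace H G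
  obtain ⟨V, hV, hstable⟩ := exists_nhds_image_subset_of_strict_local_max
    (continuous_trace_adjointRep I) (eventually_re_trace_adjointRep_lt I hcenter)
    ((continuous_const_mul g).continuousAt.preimage_mem_nhds ((mul_one g).symm ▸ hU))
  refine ⟨(g⁻¹ * ·) ⁻¹' V,
    (continuous_const_mul g⁻¹).continuousAt.preimage_mem_nhds ((inv_mul_cancel g).symm ▸ hV), ?_⟩
  rintro _ ⟨e, rfl, he, he'⟩ hg
  have htrace (h : G) : LinearMap.trace ℝ _ (adjointRep I h) =
      LinearMap.trace ℝ _ (adjointRep I (e h)) :=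
    (trace_adjointRep_map I (he.mdifferentiable (by simp) 1) (he'.mdifferentiable (by simp) 1)
      h).symm
  have heU := hstable e he.continuous.continuousOn (map_one e) fun h _ => (htrace h).le
  rintro _ ⟨x, hx, rfl⟩
  simpa [hg] using heU ⟨g⁻¹ * x, hx, rfl⟩

theorem mainTheorem2
    {E : Type*} [NormedAddCommGroup E] [NormedSpace ℝ E] [FiniteDimensional ℝ E]
    {H : Type*} [TopologicalSpace H] (I : ModelWithCorners ℝ E H) [I.Boundaryless]
    {G : Type*} [TopologicalSpace G] [ChartedSpace H G] [Group G] [LieGroup I ∞ G]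
    [T2Space G] [ConnectedSpace G] [CompactSpace G]
    (hG : IsSemisimpleLieGroup I G)
    (X : (g : G) → TangentSpace I g) (hX : IsLinearVectorField I X)
    (φ : ℝ → G → G) (hφ : IsFlowOf I φ X)
    (g : G) (hg : IsFlowFixedPoint φ g) :
    IsStablePoint φ g := by
  have : CompleteSpace E := FiniteDimensional.complete ℝ E
  intro U hU
  obtain ⟨V, hV, hVU⟩ := mainTheorem2_general I (fun _ => hG.eq_zero_of_lie_eq_zero) hU
  exact ⟨V, hV, fun t _ => hVU (φ t) (hX.isLieGroupAutomorphism hφ t) (hg t)⟩
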